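/- Let $d\ge 1$ and let $P\subset\mathbb R^d$ be a $d$-dimensional lattice polytope, i.e. the convex hull of finitely many points of $\mathbb Z^d$, with $\dim P=d$. Suppose that $P$ is integrally closed: for every $c\in\mathbb N$ and every $z\in cP\cap\mathbb Z^d$ there exist $x_1,\dots,x_c\in P\cap\mathbb Z^d$ with $z=x_1+\cdots+x_c$. For $m\ge 1$ let $L_{\partial P}(m)=|m(\partial P)\cap\mathbb Z^d|$, where $\partial P$ is the boundary of $P$ in $\mathbb R^d$. Then the sequence $(b_m)_{m\ge 0}$ with $b_0=1$ and $b_m=L_{\partial P}(m)$ for $m\ge 1$ is a differentiable $O$-sequence. Here a sequence $(k_0,k_1,\dots)$ of nonnegative integers is an $O$-sequence if there is a nonempty set $M$ of monomials in finitely many variables $y_1,\dots,y_n$ that is closed under taking divisors and satisfies $k_i=|\{u\in M:\deg u=i\}|$ for all $i\ge 0$. An $O$-sequence $(b_i)_{i\ge0}$ is differentiable if the difference sequence $c_0=b_0$, $c_i=b_i-b_{i-1}$ $(i\ge 1)$ is again an $O$-sequence. -/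

import Mathlib

open scoped Pointwise

/-- The inclusion of the lattice `ℤ^d` into `ℝ^d`. -/
def latticePoint {d : ℕ} (z : Fin d → ℤ) : Fin d → ℝ := fun i => (z i : ℝ)

/-- A lattice polytope in `ℝ^d`: the convex hull of finitely many points of `ℤ^d`. -/
def IsLatticePolytope {d : ℕ} (P : Set (Fin d → ℝ)) : Prop :=
  ∃ V : Finset (Fin d → ℤ), P = convexHull ℝ (latticePoint '' (V : Set (Fin d → ℤ)))

/-- `P ⊆ ℝ^d` has (maximal) dimension `d`. -/
def IsFullDimensional {d : ℕ} (P : Set (Fin d → ℝ)) : Prop :=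
  affineSpan ℝ P = ⊤

/-- `P` is integrally closed: for each `c ∈ ℕ`, each lattice point of `cP` is a sum of `c`
lattice points of `P`. -/
def IsIntegrallyClosedPolytope {d : ℕ} (P : Set (Fin d → ℝ)) : Prop :=
  ∀ (c : ℕ) (z : Fin d → ℤ), latticePoint z ∈ (c : ℝ) • P →
    ∃ x : Fin c → (Fin d → ℤ), (∀ i, latticePoint (x i) ∈ P) ∧ ∑ i, x i = z

/-- `L_S(m) = |mS ∩ ℤ^d|`, the number of lattice points in the dilate `mS` (the sets `S` it is
used for are bounded, so this number is finite). -/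
noncomputable def latticeCount {d : ℕ} (S : Set (Fin d → ℝ)) (m : ℕ) : ℕ :=
  {z : Fin d → ℤ | latticePoint z ∈ (m : ℝ) • S}.ncard

/-- `L_{∂P}(m) = |m(∂P) ∩ ℤ^d|`, with `∂P` the topological boundary of `P` in `ℝ^d`. -/
noncomputable def boundaryLatticeCount {d : ℕ} (P : Set (Fin d → ℝ)) (m : ℕ) : ℕ :=
  latticeCount (frontier P) m

/-- `k_0, k_1, …` is an `O`-sequence: there is a (nonempty) order ideal `M` of monomials in finitely
many variables `y_1, …, y_n` such that `k_i` is the number of monomials of degree `i` in `M`.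
A monomial is given by its exponent vector, so that divisibility is the componentwise order and an
order ideal is a lower set. -/
def IsOSequence (k : ℕ → ℤ) : Prop :=
  ∃ (n : ℕ) (M : Set (Fin n →₀ ℕ)), M.Nonempty ∧ IsLowerSet M ∧
    ∀ i : ℕ, k i = ({u ∈ M | u.degree = i}.ncard : ℤ)

/-- The difference sequence `c_i = b_i - b_{i-1}` for `i ≥ 0`, with `b_{-1} = 0`. -/
def differenceSequence (b : ℕ → ℤ) : ℕ → ℤ
  | 0 => b 0
  | i + 1 => b (i + 1) - b i

/-- An `O`-sequence is differentiable if its difference sequence is again an `O`-sequence. -/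
def IsDifferentiableOSequence (b : ℕ → ℤ) : Prop :=
  IsOSequence b ∧ IsOSequence (differenceSequence b)

/-! The boundary counts are the Hilbert function of an algebra generated in degree one that has a
linear nonzerodivisor. In the product of copies of ℚ[ℤ^d], one for each supporting half-space of
`P`, let a lattice point `z` of `mP` have component `z` where the `m`-th dilate of the face contains
it and 0 elsewhere (`faceMonomial`). These elements multiply like lattice points. Those of interior
points vanish, those of boundary points are linearly independent, and integral closedness makes each
a monomial in degree-one elements.

Macaulay's standard monomials turn such a Hilbert function into an O-sequence
(`isOSequence_of_filtration`). The sum θ of the degree-one elements is nonzero in every component,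
because every face used contains a lattice point; as ℚ[ℤ^d] is a domain, θ is a nonzerodivisor.
Dividing by θ realises the difference sequence. -/

/-! ### Standard monomials and O-sequences -/

open Submodule in
theorem finrank_sup_span_singleton_of_notMem {K W : Type*} [Field K] [AddCommGroup W] [Module K W]
    (U : Submodule K W) [FiniteDimensional K U] {x : W} (hx : x ∉ U) :
    Module.finrank K (U ⊔ span K {x} : Submodule K W) = Module.finrank K U + 1 := by
  have h := Submodule.finrank_sup_add_finrank_inf_eq U (span K {x})
  have hx0 : x ≠ 0 := fun h0 => hx (h0 ▸ U.zero_mem)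
  have hinf : U ⊓ span K {x} = ⊥ := by
    exact disjoint_iff.1 ((Submodule.disjoint_span_singleton' hx0).2 hx)
  rw [hinf, finrank_bot, finrank_span_singleton hx0] at h
  simpa using h

open Submodule in
/-- Counting a greedily chosen basis of a quotient. -/
theorem finrank_sup_span_image_eq_add_card {K W E : Type*} [Field K] [AddCommGroup W] [Module K W]
    [LinearOrder E] (U : Submodule K W) [FiniteDimensional K U] (e : E → W) (s : Finset E) :
    Module.finrank K (U ⊔ span K (e '' (s : Set E)) : Submodule K W) =
      Module.finrank K U + Set.ncard {u | u ∈ s ∧ e u ∉ U ⊔ span K (e '' {v | v ∈ s ∧ v < u})} := by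
  induction s using Finset.induction_on_max with
  | empty => rw [Finset.coe_empty, Set.image_empty, span_empty, sup_bot_eq]; simp
  | insert a s ha ih =>
    have has : a ∉ s := fun h => lt_irrefl _ (ha a h)
    have h1 : {v | v ∈ insert a s ∧ v < a} = (s : Set E) := by
      ext v
      simp only [Finset.mem_insert, Set.mem_ofPred_eq, Finset.mem_coe]
      exact ⟨fun ⟨h, hlt⟩ => h.resolve_left hlt.ne, fun h => ⟨Or.inr h, ha v h⟩⟩
    have h2 : ∀ u ∈ s, {v | v ∈ insert a s ∧ v < u} = {v | v ∈ s ∧ v < u} := by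
      intro u hu
      ext v
      simp only [Finset.mem_insert, Set.mem_ofPred_eq]
      exact ⟨fun ⟨h, hlt⟩ => ⟨h.resolve_left (hlt.trans (ha u hu)).ne, hlt⟩,
        fun h => ⟨Or.inr h.1, h.2⟩⟩
    have hsplit : U ⊔ span K (e '' ((insert a s : Finset E) : Set E)) =
        (U ⊔ span K (e '' (s : Set E))) ⊔ span K {e a} := by
      rw [Finset.coe_insert, Set.image_insert_eq, span_insert, sup_assoc,
        sup_comm (span K {e a})]
    have : FiniteDimensional K (span K (e '' (s : Set E))) :=
      FiniteDimensional.span_of_finite K (s.finite_toSet.image e)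
    rw [hsplit]
    by_cases hmem : e a ∈ U ⊔ span K (e '' (s : Set E))
    · rw [sup_eq_left.2 (by simpa using hmem), ih]
      congr 2
      ext u
      simp only [Set.mem_ofPred_eq]
      constructor
      · rintro ⟨hu, h⟩
        exact ⟨Finset.mem_insert_of_mem hu, by rwa [h2 u hu]⟩
      · rintro ⟨hu, h⟩
        rcases Finset.mem_insert.1 hu with rfl | hu
        · rw [h1] at h
          exact absurd hmem h
        · exact ⟨hu, by rwa [h2 u hu] at h⟩
    · rw [finrank_sup_span_singleton_of_notMem _ hmem, ih, add_assoc, ← Set.ncard_insert_of_notMem]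
      · congr 2
        ext u
        simp only [Set.mem_ofPred_eq, Set.mem_insert_iff]
        constructor
        · rintro (rfl | ⟨hu, h⟩)
          · exact ⟨Finset.mem_insert_self _ _, by rwa [h1]⟩
          · exact ⟨Finset.mem_insert_of_mem hu, by rwa [h2 u hu]⟩
        · rintro ⟨hu, h⟩
          rcases Finset.mem_insert.1 hu with rfl | hu
          · exact Or.inl rfl
          · exact Or.inr ⟨hu, by rwa [h2 u hu] at h⟩
      · exact fun h => has h.1

/-- The monomial in the elements `a j` with exponent vector `u`. -/
def monomialValue {A : Type*} [CommRing A] {n : ℕ} (a : Fin n → A) (u : Fin n →₀ ℕ) : A :=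
  u.prod fun j k => a j ^ k

theorem monomialValue_zero {A : Type*} [CommRing A] {n : ℕ} (a : Fin n → A) :
    monomialValue a 0 = 1 := by
  simp [monomialValue]

theorem monomialValue_add {A : Type*} [CommRing A] {n : ℕ} (a : Fin n → A) (u v : Fin n →₀ ℕ) :
    monomialValue a (u + v) = monomialValue a u * monomialValue a v :=
  Finsupp.prod_add_index' (fun _ => pow_zero _) (fun _ _ _ => pow_add _ _ _)

theorem monomialValue_single {A : Type*} [CommRing A] {n : ℕ} (a : Fin n → A) (j : Fin n) :
    monomialValue a (Finsupp.single j 1) = a j := by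
  simp [monomialValue]

/-- The span of the monomials of degree `i` in the elements `a j`. -/
def monomialSpan (K : Type*) {A : Type*} [Field K] [CommRing A] [Algebra K A] {n : ℕ}
    (a : Fin n → A) (i : ℕ) : Submodule K A :=
  Submodule.span K (monomialValue a '' {u | u.degree = i})

instance {K A : Type*} [Field K] [CommRing A] [Algebra K A] {n : ℕ} (a : Fin n → A) (i : ℕ) :
    FiniteDimensional K (monomialSpan K a i) :=
  FiniteDimensional.span_of_finite K ((Finsupp.finite_of_degree_eq i).image _)

theorem mul_mem_monomialSpan {K A : Type*} [Field K] [CommRing A] [Algebra K A] {n : ℕ}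
    (a : Fin n → A) (i : ℕ) (j : Fin n) {x : A} (hx : x ∈ monomialSpan K a i) :
    a j * x ∈ monomialSpan K a (i + 1) := by
  induction hx using Submodule.span_induction with
  | mem x hx =>
    obtain ⟨u, hu, rfl⟩ := hx
    refine Submodule.subset_span ⟨Finsupp.single j 1 + u, ?_, ?_⟩
    · simp only [Set.mem_ofPred_eq] at hu ⊢
      rw [map_add, hu, Finsupp.degree_single, add_comm]
    · rw [monomialValue_add, monomialValue_single]
  | zero => simp
  | add x y _ _ hx hy => rw [mul_add]; exact add_mem hx hy
  | smul c x _ hx => rw [mul_smul_comm]; exact Submodule.smul_mem _ _ hx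

theorem monomialValue_mul_mem {K A : Type*} [Field K] [CommRing A] [Algebra K A] {n : ℕ}
    (a : Fin n → A) (U : ℕ → Submodule K A) (hmul : ∀ i j, ∀ x ∈ U i, a j * x ∈ U (i + 1))
    (w : Fin n →₀ ℕ) : ∀ i, ∀ x ∈ U i, monomialValue a w * x ∈ U (i + w.degree) := by
  induction w using Finsupp.induction_linear with
  | zero => simp [monomialValue_zero]
  | add u v hu hv =>
    intro i x hx
    rw [monomialValue_add, map_add, add_comm u.degree, ← add_assoc, mul_assoc]
    exact hu _ _ (hv _ _ hx)
  | single j k =>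
    induction k with
    | zero => simp [monomialValue_zero]
    | succ k ih =>
      intro i x hx
      rw [Finsupp.single_add, monomialValue_add, map_add, ← add_assoc, monomialValue_single,
        Finsupp.degree_single j 1, mul_comm (monomialValue _ _), mul_assoc]
      exact hmul _ _ _ (ih _ _ hx)

/-- The standard monomials with respect to the lexicographic order form an order ideal, which
realises the Hilbert function of the monomial spans modulo the subspaces `U i`. -/
theorem isOSequence_of_filtration {K A : Type*} [Field K] [CommRing A] [Algebra K A] {n : ℕ}
    (a : Fin n → A) (U : ℕ → Submodule K A) [∀ i, FiniteDimensional K (U i)]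
    (hmul : ∀ i j, ∀ x ∈ U i, a j * x ∈ U (i + 1)) (hone : (1 : A) ∉ U 0) :
    IsOSequence fun i =>
      (Module.finrank K (U i ⊔ monomialSpan K a i : Submodule K A) : ℤ) -
        Module.finrank K (U i) := by
  classical
  -- Only monomials of equal degree are compared, so the spans in different degrees may overlap and
  -- `A` needs no grading.
  let N : (Fin n →₀ ℕ) → Submodule K A := fun u =>
    U u.degree ⊔ Submodule.span K (monomialValue a '' {v | v.degree = u.degree ∧ toLex v < toLex u})
  have hN : ∀ u w, ∀ x ∈ N u, monomialValue a w * x ∈ N (u + w) := by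
    intro u w x hx
    obtain ⟨y, hy, z, hz, rfl⟩ := Submodule.mem_sup.1 hx
    rw [mul_add]
    refine add_mem (Submodule.mem_sup_left ?_) (Submodule.mem_sup_right ?_)
    · rw [map_add]
      exact monomialValue_mul_mem a U hmul w _ _ hy
    · clear hx
      induction hz using Submodule.span_induction with
      | mem x hx =>
        obtain ⟨v, ⟨hv, hlt⟩, rfl⟩ := hx
        refine Submodule.subset_span ⟨v + w, ⟨?_, ?_⟩, ?_⟩
        · rw [map_add, map_add, hv]
        · rw [toLex_add, toLex_add]
          exact add_lt_add_left hlt _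
        · rw [monomialValue_add, mul_comm]
      | zero => simp
      | add x y _ _ hx hy => rw [mul_add]; exact add_mem hx hy
      | smul c x _ hx => rw [mul_smul_comm]; exact Submodule.smul_mem _ _ hx
  refine ⟨n, {u | monomialValue a u ∉ N u}, ⟨0, ?_⟩, ?_, ?_⟩
  · have hemp : {v : Fin n →₀ ℕ | v.degree = (0 : Fin n →₀ ℕ).degree ∧ toLex v < toLex 0} = ∅ := by
      ext v
      simp only [map_zero, Finsupp.degree_eq_zero_iff, Set.mem_ofPred_eq, Set.mem_empty_iff_false,
        iff_false, not_and]
      rintro rfl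
      exact lt_irrefl _
    simp only [N, Set.mem_ofPred_eq, hemp]
    simpa [monomialValue_zero] using hone
  · intro u v hvu hu hv
    obtain ⟨w, rfl⟩ := exists_add_of_le hvu
    refine hu ?_
    rw [monomialValue_add, mul_comm]
    exact hN _ _ _ hv
  · intro i
    let s : Finset (Lex (Fin n →₀ ℕ)) :=
      ((Finsupp.finite_of_degree_eq (σ := Fin n) i).toFinset).map toLex.toEmbedding
    have hs : ∀ u : Fin n →₀ ℕ, toLex u ∈ s ↔ u.degree = i := by
      intro u; simp [s]
    have key := finrank_sup_span_image_eq_add_card (U i)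
      (fun u : Lex (Fin n →₀ ℕ) => monomialValue a (ofLex u)) s
    have himg : (fun u : Lex (Fin n →₀ ℕ) => monomialValue a (ofLex u)) '' (s : Set _) =
        monomialValue a '' {u | u.degree = i} := by
      ext x
      constructor
      · rintro ⟨u, hu, rfl⟩
        exact ⟨ofLex u, (hs (ofLex u)).1 hu, rfl⟩
      · rintro ⟨u, hu, rfl⟩
        exact ⟨toLex u, (hs u).2 hu, rfl⟩
    have hNs : ∀ u : Fin n →₀ ℕ, u.degree = i → N u = U i ⊔ Submodule.span K
        ((fun v : Lex (Fin n →₀ ℕ) => monomialValue a (ofLex v)) '' {v | v ∈ s ∧ v < toLex u}) := by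
      intro u hu
      simp only [N, hu]
      congr 2
      ext x
      constructor
      · rintro ⟨v, ⟨hv, hlt⟩, rfl⟩
        exact ⟨toLex v, ⟨(hs v).2 hv, hlt⟩, rfl⟩
      · rintro ⟨v, ⟨hv, hlt⟩, rfl⟩
        exact ⟨ofLex v, ⟨(hs (ofLex v)).1 hv, hlt⟩, rfl⟩
    have hV : monomialSpan K a i = Submodule.span K
        ((fun u : Lex (Fin n →₀ ℕ) => monomialValue a (ofLex u)) '' (s : Set _)) := by
      rw [himg]
      rfl
    beta_reduce
    rw [hV, key]
    push_cast
    rw [add_sub_cancel_left]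
    norm_cast
    refine Set.ncard_congr (fun u _ => ofLex u) ?_ (fun _ _ _ _ h => ofLex.injective h) ?_
    · rintro u ⟨hu, h⟩
      have hd : (ofLex u).degree = i := (hs (ofLex u)).1 hu
      refine ⟨?_, hd⟩
      rw [Set.mem_ofPred_eq, hNs _ hd]
      exact h
    · rintro u ⟨h, hd⟩
      rw [Set.mem_ofPred_eq, hNs _ hd] at h
      exact ⟨toLex u, ⟨(hs u).2 hd, h⟩, rfl⟩

/-- If some linear form in the `a j` is a nonzerodivisor, the Hilbert function is differentiable. -/
theorem isDifferentiableOSequence_finrank_monomialSpan {K A : Type*} [Field K] [CommRing A]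
    [Nontrivial A] [Algebra K A] {n : ℕ} (a : Fin n → A)
    (hθ : ∀ x, (∑ j, a j) * x = 0 → x = 0) :
    IsDifferentiableOSequence fun i => (Module.finrank K (monomialSpan K a i) : ℤ) := by
  constructor
  · convert isOSequence_of_filtration (K := K) a (fun _ => ⊥) (by simp) (by simp) using 1
    ext i
    rw [bot_sup_eq, finrank_bot, Nat.cast_zero, sub_zero]
  · let θ := LinearMap.mulLeft K (∑ j, a j)
    have hinj : Function.Injective θ := by
      rw [← LinearMap.ker_eq_bot, LinearMap.ker_eq_bot']
      exact hθ
    -- The degree `i + 1` part of the ideal generated by θ; by injectivity its dimension is the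
    -- Hilbert function at `i`.
    let U : ℕ → Submodule K A
      | 0 => ⊥
      | i + 1 => (monomialSpan K a i).map θ
    have hfin : ∀ i, FiniteDimensional K (U i) := by
      rintro (_ | i)
      · exact inferInstanceAs (FiniteDimensional K (⊥ : Submodule K A))
      · exact inferInstanceAs (FiniteDimensional K ((monomialSpan K a i).map θ))
    have hmul : ∀ i j, ∀ x ∈ U i, a j * x ∈ U (i + 1) := by
      rintro (_ | i) j x hx
      · rw [(Submodule.mem_bot K).1 hx, mul_zero]
        exact zero_mem _
      · obtain ⟨y, hy, rfl⟩ := hx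
        refine ⟨a j * y, mul_mem_monomialSpan a i j hy, ?_⟩
        simp only [θ, LinearMap.mulLeft_apply]
        ring
    have hle : ∀ i, U i ≤ monomialSpan K a i := by
      rintro (_ | i)
      · exact bot_le
      · rintro _ ⟨y, hy, rfl⟩
        simp only [θ, LinearMap.mulLeft_apply, Finset.sum_mul]
        exact sum_mem fun j _ => mul_mem_monomialSpan a i j hy
    convert isOSequence_of_filtration (K := K) a U hmul (by simp [U]) using 1
    ext i
    rw [sup_eq_right.2 (hle i)]
    rcases i with _ | i
    · simp [U, differenceSequence]
    · simp only [differenceSequence, U]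
      rw [(Submodule.equivMapOfInjective θ hinj (monomialSpan K a i)).finrank_eq]

/-! ### The algebra of faces -/

open Classical in
/-- The element `z` of `G` in degree `m`, seen in all the faces `L i = c i` whose `m`-th dilate
contains it. -/
noncomputable def faceMonomial {ι G : Type*} [AddCommGroup G] (L : ι → G →+ ℝ) (c : ι → ℝ)
    (m : ℕ) (z : G) : ι → AddMonoidAlgebra ℚ G :=
  fun i => if L i z = m * c i then AddMonoidAlgebra.single z 1 else 0

/-- When two upper bounds are added, equality in the sum forces equality in both. -/
theorem faceMonomial_mul {ι G : Type*} [AddCommGroup G] (L : ι → G →+ ℝ) (c : ι → ℝ)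
    {m m' : ℕ} {z z' : G} (hz : ∀ i, L i z ≤ m * c i) (hz' : ∀ i, L i z' ≤ m' * c i) :
    faceMonomial L c m z * faceMonomial L c m' z' = faceMonomial L c (m + m') (z + z') := by
  funext i
  simp only [Pi.mul_apply, faceMonomial]
  have h1 := hz i
  have h2 := hz' i
  have h3 : L i (z + z') = ((m + m' : ℕ) : ℝ) * c i ↔ L i z = m * c i ∧ L i z' = m' * c i := by
    rw [map_add, Nat.cast_add]
    constructor
    · exact fun h => ⟨by linarith, by linarith⟩
    · rintro ⟨h, h'⟩
      rw [h, h', add_mul]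
  simp only [h3, ite_and]
  split_ifs <;> simp

theorem faceMonomial_zero {ι G : Type*} [AddCommGroup G] (L : ι → G →+ ℝ) (c : ι → ℝ) :
    faceMonomial L c 0 0 = 1 := by
  funext i
  simp [faceMonomial, AddMonoidAlgebra.one_def]

/-- The sum of the elements `p j` with multiplicities `u j`. -/
def weightedSum {G : Type*} [AddCommGroup G] {n : ℕ} (p : Fin n → G) (u : Fin n →₀ ℕ) : G :=
  u.sum fun j k => k • p j

theorem weightedSum_zero {G : Type*} [AddCommGroup G] {n : ℕ} (p : Fin n → G) :
    weightedSum p 0 = 0 := by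
  simp [weightedSum]

theorem weightedSum_add {G : Type*} [AddCommGroup G] {n : ℕ} (p : Fin n → G)
    (u v : Fin n →₀ ℕ) : weightedSum p (u + v) = weightedSum p u + weightedSum p v :=
  Finsupp.sum_add_index' (fun _ => zero_nsmul _) (fun _ _ _ => add_nsmul _ _ _)

theorem weightedSum_single {G : Type*} [AddCommGroup G] {n : ℕ} (p : Fin n → G) (j : Fin n)
    (k : ℕ) : weightedSum p (Finsupp.single j k) = k • p j := by
  simp [weightedSum]

theorem map_weightedSum_le {G : Type*} [AddCommGroup G] {n : ℕ} (p : Fin n → G) (L : G →+ ℝ)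
    {c : ℝ} (hle : ∀ j, L (p j) ≤ c) (u : Fin n →₀ ℕ) : L (weightedSum p u) ≤ u.degree * c := by
  induction u using Finsupp.induction_linear with
  | zero => simp [weightedSum_zero]
  | add u v hu hv =>
    rw [weightedSum_add, map_add, map_add]
    push_cast
    linarith
  | single j k =>
    rw [weightedSum_single, Finsupp.degree_single, map_nsmul, nsmul_eq_mul]
    exact mul_le_mul_of_nonneg_left (hle j) k.cast_nonneg

theorem monomialValue_faceMonomial {ι G : Type*} [AddCommGroup G] (L : ι → G →+ ℝ) (c : ι → ℝ)
    {n : ℕ} (p : Fin n → G) (hle : ∀ i j, L i (p j) ≤ c i) (u : Fin n →₀ ℕ) :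
    monomialValue (fun j => faceMonomial L c 1 (p j)) u =
      faceMonomial L c u.degree (weightedSum p u) := by
  induction u using Finsupp.induction_linear with
  | zero => rw [monomialValue_zero, weightedSum_zero, map_zero, faceMonomial_zero]
  | add u v hu hv =>
    rw [monomialValue_add, weightedSum_add, map_add, hu, hv]
    exact faceMonomial_mul L c (fun i => map_weightedSum_le p _ (hle i) u)
      (fun i => map_weightedSum_le p _ (hle i) v)
  | single j k =>
    rw [weightedSum_single, Finsupp.degree_single]
    induction k with
    | zero => simp [monomialValue_zero, faceMonomial_zero]
    | succ k ih =>
      rw [Finsupp.single_add, monomialValue_add, monomialValue_single, ih, add_nsmul, one_nsmul]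
      refine faceMonomial_mul L c (fun i => ?_) (fun i => by simpa using hle i j)
      rw [map_nsmul, nsmul_eq_mul]
      exact mul_le_mul_of_nonneg_left (hle i j) k.cast_nonneg

/-- The sums of `m` of the `p j` that lie in the `m`-th dilate of one of the faces `L i = c i`. -/
def faceSums {ι G : Type*} [AddCommGroup G] (L : ι → G →+ ℝ) (c : ι → ℝ) {n : ℕ} (p : Fin n → G)
    (m : ℕ) : Set G :=
  {z | (∃ u : Fin n →₀ ℕ, u.degree = m ∧ weightedSum p u = z) ∧ ∃ i, L i z = m * c i}

theorem finite_faceSums {ι G : Type*} [AddCommGroup G] (L : ι → G →+ ℝ) (c : ι → ℝ) {n : ℕ}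
    (p : Fin n → G) (m : ℕ) : (faceSums L c p m).Finite := by
  refine ((Finsupp.finite_of_degree_eq m).image (weightedSum p)).subset ?_
  rintro z ⟨⟨u, hu, rfl⟩, -⟩
  exact ⟨u, hu, rfl⟩

theorem linearIndependent_faceMonomial {ι G : Type*} [AddCommGroup G] (L : ι → G →+ ℝ)
    (c : ι → ℝ) (m : ℕ) (s : Set G) (hs : ∀ z ∈ s, ∃ i, L i z = m * c i) :
    LinearIndependent ℚ fun z : s => faceMonomial L c m (z : G) := by
  classical
  rw [linearIndependent_iff']
  intro t g hg z hz
  obtain ⟨i, hi⟩ := hs z z.2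
  -- In the component of a face through `z`, the coefficient at `z` isolates `g z`.
  have h1 := congrArg (fun x : AddMonoidAlgebra ℚ G => x.coeff (z : G)) (congrFun hg i)
  simp only [Finset.sum_apply, Pi.smul_apply, Pi.zero_apply] at h1
  rw [AddMonoidAlgebra.coeff_sum, Finsupp.finsetSum_apply, Finset.sum_eq_single z] at h1
  · simpa [faceMonomial, hi] using h1
  · intro y _ hyz
    have hne : (y : G) ≠ z := fun h => hyz (Subtype.ext h)
    simp only [faceMonomial]
    split_ifs
    · simp [hne]
    · simp
  · exact fun h => absurd hz h

/-- A monomial depends only on its degree and weighted sum, and vanishes if that sum is on no face.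
-/
theorem finrank_monomialSpan_faceMonomial {ι G : Type*} [AddCommGroup G] (L : ι → G →+ ℝ)
    (c : ι → ℝ) {n : ℕ} (p : Fin n → G) (hle : ∀ i j, L i (p j) ≤ c i) (m : ℕ) :
    Module.finrank ℚ (monomialSpan ℚ (fun j => faceMonomial L c 1 (p j)) m) =
      (faceSums L c p m).ncard := by
  have hspan : monomialSpan ℚ (fun j => faceMonomial L c 1 (p j)) m =
      Submodule.span ℚ (Set.range fun z : faceSums L c p m => faceMonomial L c m (z : G)) := by
    apply le_antisymm
    · refine Submodule.span_le.2 ?_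
      rintro _ ⟨u, hu, rfl⟩
      have hu' : u.degree = m := hu
      rw [monomialValue_faceMonomial L c p hle, hu', SetLike.mem_coe]
      by_cases h : ∃ i, L i (weightedSum p u) = m * c i
      · exact Submodule.subset_span ⟨⟨weightedSum p u, ⟨u, hu', rfl⟩, h⟩, rfl⟩
      · rw [show faceMonomial L c m (weightedSum p u) = 0 from
          funext fun i => if_neg fun hi => h ⟨i, hi⟩]
        exact zero_mem _
    · refine Submodule.span_le.2 ?_
      rintro _ ⟨⟨z, ⟨u, rfl, rfl⟩, h⟩, rfl⟩
      exact Submodule.subset_span ⟨u, rfl, monomialValue_faceMonomial L c p hle u⟩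
  have : Fintype (faceSums L c p m) := (finite_faceSums L c p m).fintype
  rw [hspan, finrank_span_eq_card
    (linearIndependent_faceMonomial L c m _ fun z hz => hz.2), ← Nat.card_eq_fintype_card,
    Nat.card_coe_set_eq]

/-- The linear form given by the sum of all degree-one elements is a nonzerodivisor, since it does
not vanish on any face. -/
theorem isDifferentiableOSequence_ncard_faceSums {ι G : Type*} [Nonempty ι] [AddCommGroup G]
    [UniqueSums G] (L : ι → G →+ ℝ) (c : ι → ℝ) {n : ℕ} (p : Fin n → G)
    (hp : Function.Injective p) (hle : ∀ i j, L i (p j) ≤ c i) (hex : ∀ i, ∃ j, L i (p j) = c i) :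
    IsDifferentiableOSequence fun m => ((faceSums L c p m).ncard : ℤ) := by
  classical
  simp only [← finrank_monomialSpan_faceMonomial L c p hle]
  refine isDifferentiableOSequence_finrank_monomialSpan (K := ℚ) _ fun x hx => ?_
  funext i
  have h1 := congrFun hx i
  -- `UniqueSums G` makes the group algebra a domain.
  rw [Pi.mul_apply, Pi.zero_apply, mul_eq_zero] at h1
  refine h1.resolve_left fun h0 => ?_
  obtain ⟨j, hj⟩ := hex i
  -- As `p` is injective, the coefficient at `p j` is 1.
  have h2 := congrArg (fun x : AddMonoidAlgebra ℚ G => x.coeff (p j)) h0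
  simp only [Finset.sum_apply] at h2
  rw [AddMonoidAlgebra.coeff_sum, Finsupp.finsetSum_apply, Finset.sum_eq_single j] at h2
  · simp [faceMonomial, hj] at h2
  · intro k _ hkj
    have hne : p k ≠ p j := fun h => hkj (hp h)
    simp only [faceMonomial]
    split_ifs
    · simp [hne]
    · simp
  · exact fun h => absurd (Finset.mem_univ j) h

/-! ### Lattice polytopes and their boundary -/

theorem finite_latticePoint_mem {d : ℕ} {P : Set (Fin d → ℝ)} (hP : Bornology.IsBounded P) :
    {z : Fin d → ℤ | latticePoint z ∈ P}.Finite := by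
  obtain ⟨R, hR⟩ := hP.exists_norm_le
  refine (Set.finite_Icc (fun _ => -⌈R⌉ : Fin d → ℤ) (fun _ => ⌈R⌉)).subset fun z hz => ?_
  have h : ∀ i, |(z i : ℝ)| ≤ ⌈R⌉ := fun i =>
    ((norm_le_pi_norm (latticePoint z) i).trans (hR _ hz)).trans (Int.le_ceil R)
  refine ⟨fun i => ?_, fun i => ?_⟩
  · exact_mod_cast (abs_le.1 (h i)).1
  · exact_mod_cast (abs_le.1 (h i)).2

/-- The inclusion of the lattice as a homomorphism. -/
def latticeHom (d : ℕ) : (Fin d → ℤ) →+ (Fin d → ℝ) where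
  toFun := latticePoint
  map_zero' := by ext; simp [latticePoint]
  map_add' _ _ := by ext; simp [latticePoint]

/-- Supporting half-spaces `f ≤ c` of `P` whose boundary contains a lattice point of `P`. -/
def SupportingFunctional {d : ℕ} (P : Set (Fin d → ℝ)) : Type :=
  {q : ((Fin d → ℝ) →L[ℝ] ℝ) × ℝ //
    q.1 ≠ 0 ∧ (∀ x ∈ P, q.1 x ≤ q.2) ∧ ∃ z, latticePoint z ∈ P ∧ q.1 (latticePoint z) = q.2}

theorem exists_supportingFunctional {d : ℕ} {P : Set (Fin d → ℝ)} (hP : IsLatticePolytope P)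
    (hne : P.Nonempty) {f : (Fin d → ℝ) →L[ℝ] ℝ} (hf : f ≠ 0) :
    ∃ q : SupportingFunctional P, q.1.1 = f := by
  obtain ⟨V, rfl⟩ := hP
  have hV : V.Nonempty := by
    rw [convexHull_nonempty_iff, Set.image_nonempty] at hne
    exact_mod_cast hne
  obtain ⟨v, hv, hmax⟩ := V.exists_max_image (fun z => f (latticePoint z)) hV
  refine ⟨⟨(f, f (latticePoint v)), hf, fun x hx => ?_, v, subset_convexHull ℝ _ ⟨v, hv, rfl⟩, rfl⟩,
    rfl⟩
  refine convexHull_min (t := {x | f x ≤ f (latticePoint v)}) ?_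
    (convex_halfSpace_le f.toLinearMap.isLinear _) hx
  rintro _ ⟨z, hz, rfl⟩
  exact hmax z hz

theorem IsLatticePolytope.convex {d : ℕ} {P : Set (Fin d → ℝ)} (hP : IsLatticePolytope P) :
    Convex ℝ P := by
  obtain ⟨V, rfl⟩ := hP
  exact convex_convexHull ℝ _

theorem IsLatticePolytope.isCompact {d : ℕ} {P : Set (Fin d → ℝ)} (hP : IsLatticePolytope P) :
    IsCompact P := by
  obtain ⟨V, rfl⟩ := hP
  exact (V.finite_toSet.image _).isCompact_convexHull ℝ

/-- Hahn–Banach supports `P` at a boundary point; conversely a nonzero functional is an open map, so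
it has no maximum at an interior point. No facet description is needed. -/
theorem mem_frontier_iff_exists_supportingFunctional {d : ℕ} {P : Set (Fin d → ℝ)}
    (hP : IsLatticePolytope P) (hdim : IsFullDimensional P) (x : Fin d → ℝ) :
    x ∈ frontier P ↔ x ∈ P ∧ ∃ q : SupportingFunctional P, q.1.1 x = q.1.2 := by
  have hint : (interior P).Nonempty :=
    hP.convex.interior_nonempty_iff_affineSpan_eq_top.2 hdim
  rw [hP.isCompact.isClosed.frontier_eq, Set.mem_sdiff]
  refine and_congr_right fun hx => ⟨fun hxi => ?_, ?_⟩
  · obtain ⟨f, hf⟩ := geometric_hahn_banach_open_point hP.convex.interior isOpen_interior hxi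
    have hf0 : f ≠ 0 := by
      rintro rfl
      obtain ⟨y, hy⟩ := hint
      simpa using hf y hy
    obtain ⟨q, rfl⟩ := exists_supportingFunctional hP ⟨x, hx⟩ hf0
    refine ⟨q, le_antisymm (q.2.2.1 x hx) ?_⟩
    obtain ⟨z, hz, hzq⟩ := q.2.2.2
    -- Separation bounds `q` only on the interior; its closure contains the maximising lattice point
    -- `z`.
    have hcl : closure (interior P) ⊆ {y | q.1.1 y ≤ q.1.1 x} :=
      closure_minimal (fun y hy => (hf y hy).le) (isClosed_le q.1.1.continuous continuous_const)
    rw [← hzq]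
    refine hcl ?_
    rw [hP.convex.closure_interior_eq_closure_of_nonempty_interior hint]
    exact subset_closure hz
  · rintro ⟨q, hq⟩ hxi
    have hopen := q.1.1.isOpenMap_of_ne_zero q.2.1 _ (isOpen_interior (s := P))
    have hsub : q.1.1 '' interior P ⊆ Set.Iic q.1.2 := by
      rintro _ ⟨y, hy, rfl⟩
      exact q.2.2.1 y (interior_subset hy)
    have := interior_maximal hsub hopen ⟨x, hxi, rfl⟩
    rw [interior_Iic, hq] at this
    exact lt_irrefl _ (Set.mem_Iio.1 this)

theorem latticePoint_weightedSum_mem {d n : ℕ} {P : Set (Fin d → ℝ)} (hconv : Convex ℝ P)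
    (hne : P.Nonempty) (p : Fin n → Fin d → ℤ) (hp : ∀ j, latticePoint (p j) ∈ P)
    (u : Fin n →₀ ℕ) : latticePoint (weightedSum p u) ∈ (u.degree : ℝ) • P := by
  change latticeHom d _ ∈ _
  induction u using Finsupp.induction_linear with
  | zero => simp [weightedSum_zero, Set.zero_smul_set hne]
  | add u v hu hv =>
    rw [weightedSum_add, map_add, map_add, Nat.cast_add,
      hconv.add_smul (Nat.cast_nonneg _) (Nat.cast_nonneg _)]
    exact Set.add_mem_add hu hv
  | single j k =>
    rw [weightedSum_single, Finsupp.degree_single, map_nsmul, ← Nat.cast_smul_eq_nsmul ℝ]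
    exact Set.smul_mem_smul_set (hp j)

theorem exists_weightedSum_eq {d n m : ℕ} {P : Set (Fin d → ℝ)} (p : Fin n → Fin d → ℤ)
    (hp : ∀ z, latticePoint z ∈ P → ∃ j, p j = z) (x : Fin m → Fin d → ℤ)
    (hx : ∀ k, latticePoint (x k) ∈ P) :
    ∃ u : Fin n →₀ ℕ, u.degree = m ∧ weightedSum p u = ∑ k, x k := by
  choose j hj using fun k => hp (x k) (hx k)
  have hsum : ∀ s : Finset (Fin m),
      weightedSum p (∑ k ∈ s, Finsupp.single (j k) 1) = ∑ k ∈ s, x k := by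
    intro s
    induction s using Finset.cons_induction with
    | empty => simp [weightedSum_zero]
    | cons a s ha ih =>
      rw [Finset.sum_cons, Finset.sum_cons, weightedSum_add, ih, weightedSum_single, one_nsmul, hj]
  exact ⟨∑ k, Finsupp.single (j k) 1, by simp [map_sum], hsum _⟩

theorem mainTheorem10 (d : ℕ) (hd : 1 ≤ d) (P : Set (Fin d → ℝ))
    (hP : IsLatticePolytope P) (hdim : IsFullDimensional P)
    (hic : IsIntegrallyClosedPolytope P) :
    IsDifferentiableOSequence
      (fun m : ℕ => if m = 0 then 1 else (boundaryLatticeCount P m : ℤ)) := by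
  have hne : P.Nonempty := by
    have hint : (interior P).Nonempty :=
      hP.convex.interior_nonempty_iff_affineSpan_eq_top.2 hdim
    exact hint.mono interior_subset
  have hfin := finite_latticePoint_mem hP.isCompact.isBounded
  have : Fintype {z : Fin d → ℤ | latticePoint z ∈ P} := hfin.fintype
  let e := Fintype.equivFin {z : Fin d → ℤ | latticePoint z ∈ P}
  let p : Fin _ → Fin d → ℤ := fun j => (e.symm j : Fin d → ℤ)
  have hpinj : Function.Injective p := Subtype.val_injective.comp e.symm.injective
  have hpmem : ∀ j, latticePoint (p j) ∈ P := fun j => (e.symm j).2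
  have hpsurj : ∀ z, latticePoint z ∈ P → ∃ j, p j = z := fun z hz =>
    ⟨e ⟨z, hz⟩, by simp only [p, Equiv.symm_apply_apply]⟩
  let L : SupportingFunctional P → (Fin d → ℤ) →+ ℝ := fun q =>
    (q.1.1 : (Fin d → ℝ) →+ ℝ).comp (latticeHom d)
  let c : SupportingFunctional P → ℝ := fun q => q.1.2
  have hnonempty : Nonempty (SupportingFunctional P) := by
    -- Here `1 ≤ d` enters: without a nonzero functional the product would be the zero ring.
    let f : (Fin d → ℝ) →L[ℝ] ℝ := ContinuousLinearMap.proj ⟨0, hd⟩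
    have hf : f ≠ 0 := fun h => by simpa [f] using DFunLike.congr_fun h (fun _ => 1)
    exact ⟨(exists_supportingFunctional hP hne hf).choose⟩
  have key := isDifferentiableOSequence_ncard_faceSums L c p hpinj
    (fun q j => q.2.2.1 _ (hpmem j)) (fun q => by
      obtain ⟨z, hz, hzq⟩ := q.2.2.2
      obtain ⟨j, rfl⟩ := hpsurj z hz
      exact ⟨j, hzq⟩)
  convert key using 1
  funext m
  split_ifs with hm
  · subst hm
    have h0 : faceSums L c p 0 = {0} := by
      ext z
      constructor
      · rintro ⟨⟨u, hu, rfl⟩, -⟩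
        rw [(Finsupp.degree_eq_zero_iff u).1 hu, weightedSum_zero]
        rfl
      · rintro rfl
        exact ⟨⟨0, map_zero _, weightedSum_zero p⟩, hnonempty.some, by simp⟩
    rw [h0, Set.ncard_singleton, Nat.cast_one]
  · have hm0 : (m : ℝ) ≠ 0 := Nat.cast_ne_zero.2 hm
    rw [boundaryLatticeCount, latticeCount]
    congr 2
    ext z
    rw [Set.mem_ofPred_eq, Set.mem_smul_set_iff_inv_smul_mem₀ hm0,
      mem_frontier_iff_exists_supportingFunctional hP hdim,
      ← Set.mem_smul_set_iff_inv_smul_mem₀ hm0]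
    refine and_congr ⟨fun hz => ?_, ?_⟩ (exists_congr fun q => ?_)
    -- Integral closedness gives generation in degree one.
    · obtain ⟨x, hx, rfl⟩ := hic m z hz
      exact exists_weightedSum_eq p hpsurj x hx
    · rintro ⟨u, rfl, rfl⟩
      exact latticePoint_weightedSum_mem hP.convex hne p hpmem u
    · rw [map_smul, smul_eq_mul, inv_mul_eq_iff_eq_mul₀ hm0]
      rfl
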